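/- Let $(S_k)_{k\ge 0}$ be the nearest-neighbour symmetric random walk on $\mathbb Z^d$ with $S_0=0$ (i.i.d. steps, uniform on $\{\pm e_1,\dots,\pm e_d\}$), and let $\mathbb P_0$ be its law. For $n\ge 0$ and $x\in\mathbb Z^d$ let $l_n(x)=\sum_{k=0}^n \mathbf 1\{S_k=x\}$ be the local time, and for $0<b<a$ let $$\mathcal D_{b,a}=\{x\in\mathbb Z^d:\ n^b\le l_n(x)\le n^a\}.$$ Let $a,b,\gamma,\zeta,p,y$ be positive real numbers with $a>b$. **(A) Low level sets.** Let $d\ge 5$. Assume - (0) if $p>2$, then $\gamma>1+a(p-2)$; if $p\le 2$, then $\gamma>1-b(2-p)$; and one of the following: - (i) $p\ge \frac{d}{d-2}$ and $\zeta<\gamma-a(p-1)-\frac2d(\gamma-ap)$; - (ii) $1<p\le\frac{d}{d-2}$ and $\zeta<\gamma-b(p-1)-\frac2d(\gamma-bp)$. Then there is a constant $c>0$, depending only on $d,a,b,p,\gamma,\zeta,y$, such that for all sufficiently large $n$ $$\mathbb P_0\Big(\sum_{x\in\mathcal D_{b,a}} l_n(x)^p\ \ge\ n^\gamma y\Big)\le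 \exp(-c\,n^\zeta).$$ **(B) High level sets.** Let $d\ge 3$. Assume - (0) $\zeta\le\frac d2\, b$; and one of the following: - $p\ge\frac d{d-2}$, (i) $\zeta<\dfrac{\gamma}{\frac{2p}{d}+1}$, and (ii) $\zeta<\gamma-a(p-1)-\frac2d(\gamma-ap)$; - $1<p\le\frac d{d-2}$, and (iii) $\zeta<\gamma-b(p-1)-\frac2d(\gamma-bp)$. Then there is a constant $c>0$, depending only on $d,a,b,p,\gamma,\zeta,y$, such that for all sufficiently large $n$ the same inequality holds. -/

import Mathlib

open MeasureTheory ProbabilityTheory Filter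

namespace RWLocalTime

/-- The `2d` unit vectors `± e_i` of `ℤ^d`. -/
def unitSteps (d : ℕ) : Set (Fin d → ℤ) :=
  {v | ∃ i : Fin d, v = Pi.single i 1 ∨ v = Pi.single i (-1)}

/-- The law of one step of the nearest neighbour symmetric walk: uniform on `± e_i`. -/
noncomputable def stepLaw (d : ℕ) : Measure (Fin d → ℤ) :=
  uniformOn (unitSteps d)

theorem unitSteps_finite (d : ℕ) : (unitSteps d).Finite := by
  have h : unitSteps d ⊆ (Set.range fun i : Fin d => (Pi.single i 1 : Fin d → ℤ)) ∪
      Set.range fun i : Fin d => (Pi.single i (-1) : Fin d → ℤ) := by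
    rintro v ⟨i, h | h⟩
    · exact Or.inl ⟨i, h.symm⟩
    · exact Or.inr ⟨i, h.symm⟩
  exact ((Set.finite_range _).union (Set.finite_range _)).subset h

theorem isProbabilityMeasure_stepLaw {d : ℕ} (hd : 0 < d) :
    IsProbabilityMeasure (stepLaw d) :=
  isProbabilityMeasure_uniformOn (unitSteps_finite d)
    ⟨Pi.single ⟨0, hd⟩ 1, ⟨0, hd⟩, Or.inl rfl⟩

/-- The probability `ℙ₀` on sequences of increments: the steps are independent, each with law
`stepLaw d`. (For `d ≥ 1`; the walk has no steps in dimension `0`.) -/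
noncomputable def walkMeasure (d : ℕ) : Measure (ℕ → Fin d → ℤ) :=
  Measure.infinitePi fun _ : ℕ => stepLaw d

theorem isProbabilityMeasure_walkMeasure {d : ℕ} (hd : 0 < d) :
    IsProbabilityMeasure (walkMeasure d) := by
  have := isProbabilityMeasure_stepLaw hd
  unfold walkMeasure
  infer_instance

/-- The position `S_k` of the walk started at `S_0 = 0`, as a function of the increments. -/
def walk {d : ℕ} (ω : ℕ → Fin d → ℤ) (k : ℕ) : Fin d → ℤ :=
  ∑ i ∈ Finset.range k, ω i

/-- The local time `l_n(x) = ∑_{k=0}^n 1{S_k = x}`. -/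
def localTime {d : ℕ} (ω : ℕ → Fin d → ℤ) (n : ℕ) (x : Fin d → ℤ) : ℕ :=
  ∑ k ∈ Finset.range (n + 1), if walk ω k = x then 1 else 0

/-- The level set `D_{b,a} = {x : n^b ≤ l_n(x) ≤ n^a}` of the local time at time `n`. -/
def levelSet {d : ℕ} (ω : ℕ → Fin d → ℤ) (n : ℕ) (b a : ℝ) : Set (Fin d → ℤ) :=
  {x | (n : ℝ) ^ b ≤ (localTime ω n x : ℝ) ∧ (localTime ω n x : ℝ) ≤ (n : ℝ) ^ a}

/-- `∑_{x ∈ D_{b,a}} l_n(x)^p`. For `p ≠ 0` only the finitely many visited sites contribute. -/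
noncomputable def levelPowerSum {d : ℕ} (ω : ℕ → Fin d → ℤ) (n : ℕ) (b a p : ℝ) : ℝ :=
  ∑ᶠ x ∈ levelSet ω n b a, (localTime ω n x : ℝ) ^ p

end RWLocalTime

/-! The core is the bound P(#{x : l_n(x) ≥ n^β} ≥ K) ≤ exp(-c K^{1-2/d} n^β), valid for d ≥ 3.

For a finite set A whose potential (expected time spent in A up to n) is at most g at every point of
A, the function 1 + potential is a supersolution for the walk weighted by 1 + 1/g at each visit to
A. Feynman-Kac then bounds E (1 + 1/g)^{time in A} by n + 2, and Markov's inequality shows that all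
local times on A exceed m with probability at most (n + 2) exp(-c|A|m)
(`measure_forall_le_localTime_le`).

An arbitrary B may be clustered, with potential of order |B|^{2/d} by heat kernel decay. Splitting B
into about |B|^{2/d} classes that share the Green interaction evenly gives a subset of about
|B|^{1-2/d} points with bounded potential (`exists_subset_potential_le`). A union bound over such
subsets costs a polynomial factor per point, negligible against exp(-c n^β) per point.

Finally [b, a] is cut into finitely many thin slices. If the power sum reaches n^γ y, some slice
near level β has about n^{γ-pβ} sites, which costs the exponent (γ - pβ)(1 - 2/d) + β. This is
affine in β, so its minimum is at an endpoint, and p versus d/(d-2) decides which one. Both parts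
follow from this one estimate. -/

namespace RWLocalTime

/-! ### Integrals over the circle -/

/-- The normalized Haar measure of the circle, on the fundamental domain `(-π/2, 3π/2]`. -/
noncomputable def circleMeasure : Measure ℝ :=
  ENNReal.ofReal (2 * Real.pi)⁻¹ • volume.restrict (Set.Ioc (-(Real.pi / 2)) (3 * Real.pi / 2))

theorem integral_circleMeasure {E : Type*} [NormedAddCommGroup E] [NormedSpace ℝ E] (f : ℝ → E) :
    ∫ t, f t ∂circleMeasure =
      (2 * Real.pi)⁻¹ • ∫ t in (-(Real.pi / 2))..(3 * Real.pi / 2), f t := by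
  have hle : -(Real.pi / 2) ≤ 3 * Real.pi / 2 := by linarith [Real.pi_pos]
  rw [circleMeasure, integral_smul_measure, intervalIntegral.integral_of_le hle,
    ENNReal.toReal_ofReal (by positivity)]

instance isProbabilityMeasure_circleMeasure : IsProbabilityMeasure circleMeasure := by
  constructor
  have h : 3 * Real.pi / 2 - -(Real.pi / 2) = 2 * Real.pi := by ring
  rw [circleMeasure, Measure.smul_apply, Measure.restrict_apply_univ, Real.volume_Ioc, h,
    smul_eq_mul, ← ENNReal.ofReal_mul (by positivity), inv_mul_cancel₀ (by positivity),
    ENNReal.ofReal_one]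

theorem integral_circleMeasure_exp (m : ℤ) :
    ∫ t, Complex.exp (((m : ℝ) * t : ℝ) * Complex.I) ∂circleMeasure = if m = 0 then 1 else 0 := by
  split_ifs with hm
  · simp [hm]
  · rw [integral_circleMeasure]
    have hc : (m : ℂ) * Complex.I ≠ 0 :=
      mul_ne_zero (by exact_mod_cast hm) Complex.I_ne_zero
    have h1 : (fun t : ℝ => Complex.exp (((m : ℝ) * t : ℝ) * Complex.I)) =
        fun t : ℝ => Complex.exp ((m : ℂ) * Complex.I * t) := by
      funext t; congr 1; push_cast; ring
    have h2 : Complex.exp ((m : ℂ) * Complex.I * ((3 * Real.pi / 2 : ℝ) : ℂ)) =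
        Complex.exp ((m : ℂ) * Complex.I * ((-(Real.pi / 2) : ℝ) : ℂ)) := by
      rw [Complex.exp_eq_exp_iff_exists_int]
      exact ⟨m, by push_cast; ring⟩
    rw [h1, integral_exp_mul_complex hc, h2]
    simp

/-- The function |cos| has period π, and the fundamental domain starts at -π/2 so that it splits
into two halves with one peak each. On each half 1 - cos t ≥ 2t²/π² gives a Gaussian bound. -/
theorem integral_circleMeasure_exp_neg_le {s : ℝ} (hs : 0 < s) :
    ∫ t, Real.exp (-(s * (1 - |Real.cos t|))) ∂circleMeasure ≤ 2 / Real.sqrt s := by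
  have hpi := Real.pi_pos
  have hcont : Continuous fun t : ℝ => Real.exp (-(s * (1 - |Real.cos t|))) := by fun_prop
  have hint : ∀ a b : ℝ, IntervalIntegrable
      (fun t : ℝ => Real.exp (-(s * (1 - |Real.cos t|)))) volume a b :=
    fun a b => hcont.intervalIntegrable a b
  have hsplit := intervalIntegral.integral_add_adjacent_intervals
    (hint (-(Real.pi / 2)) (Real.pi / 2)) (hint (Real.pi / 2) (3 * Real.pi / 2))
  have hshift : ∫ t in (Real.pi / 2)..(3 * Real.pi / 2), Real.exp (-(s * (1 - |Real.cos t|))) =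
      ∫ t in (-(Real.pi / 2))..(Real.pi / 2), Real.exp (-(s * (1 - |Real.cos t|))) := by
    have h := intervalIntegral.integral_comp_add_right
      (a := -(Real.pi / 2)) (b := Real.pi / 2)
      (fun t : ℝ => Real.exp (-(s * (1 - |Real.cos t|)))) Real.pi
    have e1 : -(Real.pi / 2) + Real.pi = Real.pi / 2 := by ring
    have e2 : Real.pi / 2 + Real.pi = 3 * Real.pi / 2 := by ring
    rw [e1, e2] at h
    rw [← h]
    simp
  have hb : 0 < s * (2 / Real.pi ^ 2) := by positivity
  have hgauss : ∫ t in (-(Real.pi / 2))..(Real.pi / 2), Real.exp (-(s * (1 - |Real.cos t|))) ≤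
      Real.sqrt (Real.pi / (s * (2 / Real.pi ^ 2))) := by
    rw [← integral_gaussian]
    have hle : -(Real.pi / 2) ≤ Real.pi / 2 := by linarith
    calc ∫ t in (-(Real.pi / 2))..(Real.pi / 2), Real.exp (-(s * (1 - |Real.cos t|)))
        ≤ ∫ t in (-(Real.pi / 2))..(Real.pi / 2), Real.exp (-(s * (2 / Real.pi ^ 2)) * t ^ 2) := by
          refine intervalIntegral.integral_mono_on hle (hint _ _)
            (Continuous.intervalIntegrable (by fun_prop) _ _) fun t ht => ?_
          have h0 : 0 ≤ Real.cos t := Real.cos_nonneg_of_mem_Icc ht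
          have h1 := Real.cos_le_one_sub_mul_cos_sq (x := t)
            (abs_le.2 ⟨by linarith [ht.1], by linarith [ht.2]⟩)
          rw [abs_of_nonneg h0]
          apply Real.exp_le_exp.2
          nlinarith
      _ ≤ ∫ t, Real.exp (-(s * (2 / Real.pi ^ 2)) * t ^ 2) := by
          rw [intervalIntegral.integral_of_le hle]
          exact setIntegral_le_integral (integrable_exp_neg_mul_sq hb)
            (Eventually.of_forall fun t => (Real.exp_pos _).le)
  rw [integral_circleMeasure, ← hsplit, hshift, smul_eq_mul]
  have hsq : Real.sqrt (Real.pi / (s * (2 / Real.pi ^ 2))) ≤ 2 * Real.pi / Real.sqrt s := by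
    rw [Real.sqrt_le_left (by positivity), div_pow, Real.sq_sqrt hs.le]
    rw [div_le_div_iff₀ hb hs]
    have : (2 * Real.pi) ^ 2 * (s * (2 / Real.pi ^ 2)) = 8 * s := by field_simp; ring
    rw [this]
    nlinarith [Real.pi_lt_four]
  calc (2 * Real.pi)⁻¹ * _ ≤ (2 * Real.pi)⁻¹ *
      (2 * Real.pi / Real.sqrt s + 2 * Real.pi / Real.sqrt s) := by gcongr <;> linarith
    _ = 2 / Real.sqrt s := by field_simp; ring

/-! ### Heat kernel of the walk -/

variable {d : ℕ}

/-- The average of a function over the `2d` neighbours of a site. -/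
noncomputable def neighborAvg (f : (Fin d → ℤ) → ℝ) (x : Fin d → ℤ) : ℝ :=
  (2 * d : ℝ)⁻¹ * ∑ i, (f (x + Pi.single i 1) + f (x + Pi.single i (-1)))

/-- The characteristic function of one step of the walk. -/
noncomputable def stepChar (θ : Fin d → ℝ) : ℝ :=
  (d : ℝ)⁻¹ * ∑ i, Real.cos (θ i)

/-- The transition probabilities of the walk, given by Fourier inversion. -/
noncomputable def heatKernel (d k : ℕ) (x : Fin d → ℤ) : ℝ :=
  ∫ θ : Fin d → ℝ, stepChar θ ^ k * Real.cos (∑ i, (x i : ℝ) * θ i)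
    ∂(Measure.pi fun _ : Fin d => circleMeasure)

theorem neighborAvg_mono {f g : (Fin d → ℤ) → ℝ} (h : ∀ x, f x ≤ g x) (x : Fin d → ℤ) :
    neighborAvg f x ≤ neighborAvg g x := by
  unfold neighborAvg
  gcongr <;> apply h

theorem neighborAvg_const (hd : 0 < d) (c : ℝ) (x : Fin d → ℤ) :
    neighborAvg (fun _ => c) x = c := by
  have : (d : ℝ) ≠ 0 := by positivity
  simp only [neighborAvg, Finset.sum_const, Finset.card_univ, Fintype.card_fin, nsmul_eq_mul]
  field_simp
  ring

theorem neighborAvg_add (f g : (Fin d → ℤ) → ℝ) (x : Fin d → ℤ) :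
    neighborAvg (fun z => f z + g z) x = neighborAvg f x + neighborAvg g x := by
  simp only [neighborAvg, Finset.sum_add_distrib]
  ring

theorem neighborAvg_sum {ι : Type*} (s : Finset ι) (f : ι → (Fin d → ℤ) → ℝ) (x : Fin d → ℤ) :
    neighborAvg (fun z => ∑ i ∈ s, f i z) x = ∑ i ∈ s, neighborAvg (f i) x := by
  simp only [neighborAvg, ← Finset.sum_add_distrib, ← Finset.mul_sum]
  rw [Finset.sum_comm]

theorem neighborAvg_comp_sub (f : (Fin d → ℤ) → ℝ) (y x : Fin d → ℤ) :
    neighborAvg (fun z => f (z - y)) x = neighborAvg f (x - y) := by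
  simp only [neighborAvg, add_sub_right_comm]

/-- The walk is bipartite: `stepChar` equals -1 at (π, …, π), so the bound must use |cos|. Its
exponential form factorises over coordinates after taking powers. -/
theorem abs_stepChar_le (hd : 0 < d) (θ : Fin d → ℝ) :
    |stepChar θ| ≤ Real.exp (-((d : ℝ)⁻¹ * ∑ i, (1 - |Real.cos (θ i)|))) := by
  have hd' : (d : ℝ) ≠ 0 := by positivity
  have h1 : |stepChar θ| ≤ (d : ℝ)⁻¹ * ∑ i, |Real.cos (θ i)| := by
    rw [stepChar, abs_mul, abs_of_nonneg (by positivity)]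
    gcongr
    exact Finset.abs_sum_le_sum_abs _ _
  have h2 : (d : ℝ)⁻¹ * ∑ i, |Real.cos (θ i)| =
      -((d : ℝ)⁻¹ * ∑ i, (1 - |Real.cos (θ i)|)) + 1 := by
    simp only [Finset.sum_sub_distrib, Finset.sum_const, Finset.card_univ, Fintype.card_fin,
      nsmul_eq_mul, mul_one, mul_sub, inv_mul_cancel₀ hd']
    ring
  exact (h1.trans_eq h2).trans (Real.add_one_le_exp _)

theorem abs_stepChar_le_one (hd : 0 < d) (θ : Fin d → ℝ) : |stepChar θ| ≤ 1 := by
  refine (abs_stepChar_le hd θ).trans (Real.exp_le_one_iff.2 (neg_nonpos.2 ?_))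
  exact mul_nonneg (by positivity) (Finset.sum_nonneg fun i _ => by
    linarith [Real.abs_cos_le_one (θ i)])

theorem continuous_stepChar : Continuous (stepChar (d := d)) := by
  unfold stepChar
  fun_prop

theorem integrable_stepChar_pow_mul_cos (hd : 0 < d) (k : ℕ) (x : Fin d → ℤ) :
    Integrable (fun θ : Fin d → ℝ => stepChar θ ^ k * Real.cos (∑ i, (x i : ℝ) * θ i))
      (Measure.pi fun _ : Fin d => circleMeasure) := by
  have hc := continuous_stepChar (d := d)
  refine Integrable.of_bound (Continuous.aestronglyMeasurable (by fun_prop)) 1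
    (Eventually.of_forall fun θ => ?_)
  rw [Real.norm_eq_abs, abs_mul, abs_pow]
  exact mul_le_one₀ (pow_le_one₀ (abs_nonneg _) (abs_stepChar_le_one hd θ)) (abs_nonneg _)
    (Real.abs_cos_le_one _)

theorem heatKernel_zero (x : Fin d → ℤ) : heatKernel d 0 x = if x = 0 then 1 else 0 := by
  have h1 : ∀ θ : Fin d → ℝ, stepChar θ ^ 0 * Real.cos (∑ i, (x i : ℝ) * θ i) =
      RCLike.re (∏ i, Complex.exp (((x i : ℝ) * θ i : ℝ) * Complex.I)) := by
    intro θ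
    rw [pow_zero, one_mul, ← Complex.exp_sum, ← Finset.sum_mul, ← Complex.ofReal_sum]
    exact (Complex.exp_ofReal_mul_I_re _).symm
  have hint : Integrable (fun θ : Fin d → ℝ =>
      ∏ i, Complex.exp (((x i : ℝ) * θ i : ℝ) * Complex.I))
      (Measure.pi fun _ : Fin d => circleMeasure) := by
    refine Integrable.of_bound (Continuous.aestronglyMeasurable (by fun_prop)) 1
      (Eventually.of_forall fun θ => ?_)
    rw [norm_prod]
    exact Finset.prod_le_one (fun _ _ => norm_nonneg _)
      fun i _ => (Complex.norm_exp_ofReal_mul_I _).le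
  simp only [heatKernel, h1]
  rw [integral_re hint, integral_fintype_prod_eq_prod
    (fun i (t : ℝ) => Complex.exp (((x i : ℝ) * t : ℝ) * Complex.I))]
  simp only [integral_circleMeasure_exp]
  split_ifs with hx
  · simp [hx]
  · obtain ⟨i, hi⟩ := Function.ne_iff.1 hx
    rw [Finset.prod_eq_zero (Finset.mem_univ i) (if_neg hi)]
    simp

/-- In the cosine addition formula the sine terms of e_i and -e_i cancel. Positivity and total mass
at most 1, invisible in the Fourier integral, follow from this recursion. -/
theorem neighborAvg_heatKernel (hd : 0 < d) (k : ℕ) (x : Fin d → ℤ) :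
    neighborAvg (heatKernel d k) x = heatKernel d (k + 1) x := by
  have hint := integrable_stepChar_pow_mul_cos hd k
  simp only [neighborAvg, heatKernel]
  simp_rw [← integral_add (hint _) (hint _)]
  rw [← integral_finsetSum _ fun i _ => ?_, ← integral_const_mul]
  swap
  · exact (hint (x + Pi.single i 1)).add (hint (x + Pi.single i (-1)))
  refine integral_congr_ae (Eventually.of_forall fun θ => ?_)
  have hs : ∀ (i : Fin d) (m : ℤ), ∑ j, ((x + Pi.single i m : Fin d → ℤ) j : ℝ) * θ j =
      (∑ j, (x j : ℝ) * θ j) + m * θ i := by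
    intro i m
    simp only [Pi.add_apply, Int.cast_add, add_mul, Finset.sum_add_distrib]
    congr 1
    rw [Finset.sum_eq_single i]
    · simp
    · intro j _ hj
      simp [hj]
    · simp
  simp only [hs, Real.cos_add]
  rw [pow_succ, stepChar]
  simp only [Int.cast_one, Int.cast_neg, neg_mul, one_mul, Real.cos_neg, Real.sin_neg]
  set X : ℝ := ∑ j, (x j : ℝ) * θ j
  have hterm : ∀ i, stepChar θ ^ k * (Real.cos X * Real.cos (θ i) - Real.sin X * Real.sin (θ i)) +
      stepChar θ ^ k * (Real.cos X * Real.cos (θ i) - Real.sin X * -Real.sin (θ i)) =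
      2 * stepChar θ ^ k * Real.cos X * Real.cos (θ i) := fun i => by ring
  have hfold : ((d : ℝ)⁻¹ * ∑ i, Real.cos (θ i)) = stepChar θ := rfl
  simp only [hfold, hterm, ← Finset.mul_sum]
  rw [← hfold, mul_inv]
  ring

theorem heatKernel_neg (k : ℕ) (x : Fin d → ℤ) : heatKernel d k (-x) = heatKernel d k x := by
  simp [heatKernel, Finset.sum_neg_distrib]

theorem heatKernel_nonneg (hd : 0 < d) (k : ℕ) (x : Fin d → ℤ) : 0 ≤ heatKernel d k x := by
  induction k generalizing x with
  | zero => rw [heatKernel_zero]; split_ifs <;> norm_num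
  | succ k ih =>
    rw [← neighborAvg_heatKernel hd, ← neighborAvg_const hd 0 x]
    exact neighborAvg_mono ih x

theorem sum_heatKernel_le_one (hd : 0 < d) (k : ℕ) (B : Finset (Fin d → ℤ)) (x : Fin d → ℤ) :
    ∑ y ∈ B, heatKernel d k (x - y) ≤ 1 := by
  induction k generalizing x with
  | zero =>
    simp only [heatKernel_zero, sub_eq_zero]
    rw [Finset.sum_ite_eq]
    split_ifs <;> norm_num
  | succ k ih =>
    simp only [← neighborAvg_heatKernel hd, ← neighborAvg_comp_sub (heatKernel d k)]
    rw [← neighborAvg_sum, ← neighborAvg_const hd 1 x]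
    exact neighborAvg_mono ih x

theorem heatKernel_le (hd : 0 < d) {k : ℕ} (hk : 0 < k) (x : Fin d → ℤ) :
    heatKernel d k x ≤ (2 / Real.sqrt (k / d)) ^ d := by
  have hc := continuous_stepChar (d := d)
  have hkd : (0 : ℝ) < k / d := by positivity
  have hle : ∀ θ : Fin d → ℝ, stepChar θ ^ k * Real.cos (∑ i, (x i : ℝ) * θ i) ≤
      ∏ i, Real.exp (-((k / d : ℝ) * (1 - |Real.cos (θ i)|))) := by
    intro θ
    refine (le_abs_self _).trans ?_
    rw [abs_mul, abs_pow]
    calc |stepChar θ| ^ k * |Real.cos (∑ i, (x i : ℝ) * θ i)| ≤ |stepChar θ| ^ k :=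
          mul_le_of_le_one_right (by positivity) (Real.abs_cos_le_one _)
      _ ≤ Real.exp (-((d : ℝ)⁻¹ * ∑ i, (1 - |Real.cos (θ i)|))) ^ k := by
          gcongr
          exact abs_stepChar_le hd θ
      _ = _ := by
          rw [← Real.exp_nat_mul, ← Real.exp_sum, Finset.sum_neg_distrib, ← Finset.mul_sum]
          congr 1
          ring
  calc heatKernel d k x
      ≤ ∫ θ : Fin d → ℝ, ∏ i, Real.exp (-((k / d : ℝ) * (1 - |Real.cos (θ i)|)))
          ∂(Measure.pi fun _ : Fin d => circleMeasure) := by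
        refine integral_mono (integrable_stepChar_pow_mul_cos hd k x) ?_ hle
        refine Integrable.of_bound (Continuous.aestronglyMeasurable (by fun_prop)) 1
          (Eventually.of_forall fun θ => ?_)
        rw [Real.norm_eq_abs, Finset.abs_prod]
        refine Finset.prod_le_one (fun _ _ => abs_nonneg _) fun i _ => ?_
        rw [Real.abs_exp, Real.exp_le_one_iff, neg_nonpos]
        exact mul_nonneg hkd.le (by linarith [Real.abs_cos_le_one (θ i)])
    _ = ∏ _i : Fin d, ∫ t, Real.exp (-((k / d : ℝ) * (1 - |Real.cos t|))) ∂circleMeasure :=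
        integral_fintype_prod_eq_prod
          (fun (_ : Fin d) (t : ℝ) => Real.exp (-((k / d : ℝ) * (1 - |Real.cos t|))))
    _ ≤ ∏ _i : Fin d, (2 / Real.sqrt (k / d)) :=
        Finset.prod_le_prod (fun _ _ => integral_nonneg fun _ => (Real.exp_pos _).le)
          fun _ _ => integral_circleMeasure_exp_neg_le hkd
    _ = _ := by rw [Finset.prod_const, Finset.card_univ, Fintype.card_fin]

/-! ### Partition of a weighted graph -/

/-- Lovász' partition: the points of a weighted graph can be split into `q` classes such that
the weight which a point shares with its own class is at most a fraction `1/q` of the total. -/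
theorem exists_partition_weight_le {α : Type*} [Fintype α] [DecidableEq α] (w : α → α → ℝ)
    (hsymm : ∀ x y, w x y = w y x) (hdiag : ∀ x, w x x = 0) {q : ℕ} (hq : 0 < q) :
    ∃ f : α → Fin q, ∀ x, q * ∑ y, (if f y = f x then w x y else 0) ≤ ∑ y, w x y := by
  have : Nonempty (Fin q) := ⟨⟨0, hq⟩⟩
  let energy : (α → Fin q) → ℝ := fun f => ∑ u, ∑ v, if f v = f u then w u v else 0
  have hsplit : ∀ (f : α → Fin q) (x : α), energy f =
      (∑ u ∈ Finset.univ.erase x, ∑ v ∈ Finset.univ.erase x, if f v = f u then w u v else 0) +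
        2 * ∑ v, if f v = f x then w x v else 0 := by
    intro f x
    have hin : ∀ u, ∑ v, (if f v = f u then w u v else 0) =
        (∑ v ∈ Finset.univ.erase x, if f v = f u then w u v else 0) +
          (if f x = f u then w u x else 0) := fun u =>
      (Finset.sum_erase_add _ _ (Finset.mem_univ x)).symm
    have hcol : ∑ u ∈ Finset.univ.erase x, (if f x = f u then w u x else 0) =
        ∑ v, if f v = f x then w x v else 0 := by
      rw [← Finset.sum_erase_add _ _ (Finset.mem_univ x)]
      simp only [hdiag, ite_self, add_zero]
      exact Finset.sum_congr rfl fun u _ => by rw [hsymm u x]; simp only [eq_comm]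
    show ∑ u, ∑ v, (if f v = f u then w u v else 0) = _
    rw [← Finset.sum_erase_add _ _ (Finset.mem_univ x)]
    rw [Finset.sum_congr rfl fun u _ => hin u, Finset.sum_add_distrib, hcol]
    ring
  -- At a minimiser of the monochromatic weight, moving x to another class c cannot help, so x
  -- shares no more weight with its own class than with c. Summing over c gives the factor q.
  obtain ⟨f, hf⟩ := Finite.exists_min energy
  refine ⟨f, fun x => ?_⟩
  have hmove : ∀ c : Fin q, ∑ y, (if f y = f x then w x y else 0) ≤
      ∑ y, if f y = c then w x y else 0 := by
    intro c
    have h := hf (Function.update f x c)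
    rw [hsplit f x, hsplit (Function.update f x c) x] at h
    have h1 : (∑ u ∈ Finset.univ.erase x, ∑ v ∈ Finset.univ.erase x,
        if Function.update f x c v = Function.update f x c u then w u v else 0) =
        ∑ u ∈ Finset.univ.erase x, ∑ v ∈ Finset.univ.erase x,
          if f v = f u then w u v else 0 := by
      refine Finset.sum_congr rfl fun u hu => Finset.sum_congr rfl fun v hv => ?_
      rw [Function.update_of_ne (Finset.ne_of_mem_erase hu),
        Function.update_of_ne (Finset.ne_of_mem_erase hv)]
    have h2 : (∑ v, if Function.update f x c v = Function.update f x c x then w x v else 0) =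
        ∑ v, if f v = c then w x v else 0 := by
      refine Finset.sum_congr rfl fun v _ => ?_
      rcases eq_or_ne v x with rfl | hv
      · simp [hdiag]
      · rw [Function.update_self, Function.update_of_ne hv]
    rw [h1, h2] at h
    linarith
  calc (q : ℝ) * ∑ y, (if f y = f x then w x y else 0)
      = ∑ _c : Fin q, ∑ y, (if f y = f x then w x y else 0) := by simp
    _ ≤ ∑ c : Fin q, ∑ y, (if f y = c then w x y else 0) :=
        Finset.sum_le_sum fun c _ => hmove c
    _ = ∑ y, w x y := by rw [Finset.sum_comm]; simp

/-! ### Green function and potentials of finite sets -/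

theorem inv_sqrt_succ_pow_three_le {k : ℕ} (hk : 0 < k) :
    (1 / Real.sqrt ((k + 1 : ℕ) : ℝ)) ^ 3 ≤
      2 * (1 / Real.sqrt k - 1 / Real.sqrt ((k + 1 : ℕ) : ℝ)) := by
  have hk' : (0 : ℝ) < k := by exact_mod_cast hk
  set u := Real.sqrt k with hu
  set v := Real.sqrt ((k + 1 : ℕ) : ℝ) with hv
  have hu0 : 0 < u := Real.sqrt_pos.2 hk'
  have hu2 : u ^ 2 = k := Real.sq_sqrt hk'.le
  have hv2 : v ^ 2 = k + 1 := by rw [hv, Real.sq_sqrt (by positivity)]; push_cast; ring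
  have huv : u ≤ v := Real.sqrt_le_sqrt (by push_cast; linarith)
  have hv0 : 0 < v := hu0.trans_le huv
  have e : 2 * (1 / u - 1 / v) = 2 * (v - u) / (u * v) := by field_simp
  rw [e, div_pow, one_pow, div_le_div_iff₀ (by positivity) (by positivity)]
  have h1 : (v - u) * (v + u) = 1 := by nlinarith
  have h2 : 0 ≤ v - u := by linarith
  have h3 : 1 ≤ 2 * (v - u) * v := by nlinarith
  nlinarith [mul_pos hv0 hv0, mul_le_mul_of_nonneg_right h3 (mul_pos hv0 hv0).le,
    mul_le_mul_of_nonneg_right huv hv0.le]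

/-- Terms up to T are bounded by 1; the rest telescope by `inv_sqrt_succ_pow_three_le`. -/
theorem sum_range_le_of_decay {a : ℕ → ℝ} {c : ℝ} {T : ℕ} (hT : 0 < T) (ha0 : ∀ k, 0 ≤ a k)
    (ha1 : ∀ k, a k ≤ 1) (hc : 0 ≤ c) (ha : ∀ k, T < k → a k ≤ c * (1 / Real.sqrt k) ^ 3)
    (n : ℕ) : ∑ k ∈ Finset.range (n + 1), a k ≤ T + 1 + 2 * c / Real.sqrt T := by
  have key : ∀ M : ℕ, ∑ k ∈ Finset.range (T + 1 + M), a k ≤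
      T + 1 + 2 * c * (1 / Real.sqrt T - 1 / Real.sqrt ((T + M : ℕ) : ℝ)) := by
    intro M
    induction M with
    | zero =>
      simp only [add_zero, sub_self, mul_zero]
      calc ∑ k ∈ Finset.range (T + 1), a k ≤ ∑ _k ∈ Finset.range (T + 1), (1 : ℝ) :=
            Finset.sum_le_sum fun k _ => ha1 k
        _ = T + 1 := by simp
    | succ M ih =>
      rw [← add_assoc, Finset.sum_range_succ]
      have h1 := ha (T + 1 + M) (by omega)
      have h2 := inv_sqrt_succ_pow_three_le (k := T + M) (by omega)
      rw [show T + 1 + M = T + M + 1 by ring] at h1 ⊢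
      rw [show T + (M + 1) = T + M + 1 by ring]
      rw [show T + 1 + M = T + M + 1 by ring] at ih
      have h3 := mul_le_mul_of_nonneg_left h2 hc
      linarith
  calc ∑ k ∈ Finset.range (n + 1), a k ≤ ∑ k ∈ Finset.range (T + 1 + n), a k :=
        Finset.sum_le_sum_of_subset_of_nonneg (Finset.range_mono (by omega)) fun k _ _ => ha0 k
    _ ≤ _ := key n
    _ ≤ T + 1 + 2 * c / Real.sqrt T := by
        have : 0 ≤ 2 * c * (1 / Real.sqrt ((T + n : ℕ) : ℝ)) := by positivity
        have e : 2 * c / Real.sqrt T = 2 * c * (1 / Real.sqrt T) := by ring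
        rw [e]
        linarith

/-- The Green function of the walk up to time `n`. -/
noncomputable def green (d n : ℕ) (x : Fin d → ℤ) : ℝ :=
  ∑ k ∈ Finset.range (n + 1), heatKernel d k x

/-- The expected time spent in `B` up to time `n` by the walk started at `x`. -/
noncomputable def potential (n : ℕ) (B : Finset (Fin d → ℤ)) (x : Fin d → ℤ) : ℝ :=
  ∑ y ∈ B, green d n (x - y)

theorem green_nonneg (hd : 0 < d) (n : ℕ) (x : Fin d → ℤ) : 0 ≤ green d n x :=
  Finset.sum_nonneg fun _ _ => heatKernel_nonneg hd _ _

theorem green_mono (hd : 0 < d) {m n : ℕ} (h : m ≤ n) (x : Fin d → ℤ) :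
    green d m x ≤ green d n x :=
  Finset.sum_le_sum_of_subset_of_nonneg (Finset.range_mono (by omega))
    fun _ _ _ => heatKernel_nonneg hd _ _

theorem green_neg (n : ℕ) (x : Fin d → ℤ) : green d n (-x) = green d n x := by
  simp only [green, heatKernel_neg]

theorem green_zero (x : Fin d → ℤ) : green d 0 x = if x = 0 then 1 else 0 := by
  simp [green, heatKernel_zero]

theorem green_succ (hd : 0 < d) (n : ℕ) (x : Fin d → ℤ) :
    green d (n + 1) x = (if x = 0 then 1 else 0) + neighborAvg (green d n) x := by
  have h : green d n = fun z => ∑ k ∈ Finset.range (n + 1), heatKernel d k z := rfl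
  rw [h, neighborAvg_sum, green, Finset.sum_range_succ', heatKernel_zero, add_comm]
  simp only [neighborAvg_heatKernel hd]

theorem potential_mono_time (hd : 0 < d) {m n : ℕ} (h : m ≤ n) (B : Finset (Fin d → ℤ))
    (x : Fin d → ℤ) : potential m B x ≤ potential n B x :=
  Finset.sum_le_sum fun _ _ => green_mono hd h _

theorem potential_mono_set (hd : 0 < d) (n : ℕ) {A B : Finset (Fin d → ℤ)} (h : A ⊆ B)
    (x : Fin d → ℤ) : potential n A x ≤ potential n B x :=
  Finset.sum_le_sum_of_subset_of_nonneg h fun _ _ _ => green_nonneg hd _ _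

theorem potential_zero (B : Finset (Fin d → ℤ)) (x : Fin d → ℤ) :
    potential 0 B x = if x ∈ B then 1 else 0 := by
  simp only [potential, green_zero, sub_eq_zero]
  rw [Finset.sum_ite_eq]

theorem potential_succ (hd : 0 < d) (n : ℕ) (B : Finset (Fin d → ℤ)) (x : Fin d → ℤ) :
    potential (n + 1) B x = (if x ∈ B then 1 else 0) + neighborAvg (potential n B) x := by
  have h : potential n B = fun z => ∑ y ∈ B, green d n (z - y) := rfl
  rw [h, neighborAvg_sum]
  simp only [potential, green_succ hd, Finset.sum_add_distrib, sub_eq_zero, neighborAvg_comp_sub]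
  rw [Finset.sum_ite_eq]

theorem potential_le_time (hd : 0 < d) (n : ℕ) (B : Finset (Fin d → ℤ)) (x : Fin d → ℤ) :
    potential n B x ≤ n + 1 := by
  rw [potential]
  simp only [green]
  rw [Finset.sum_comm]
  calc _ ≤ ∑ _k ∈ Finset.range (n + 1), (1 : ℝ) :=
        Finset.sum_le_sum fun k _ => sum_heatKernel_le_one hd k B x
    _ = n + 1 := by simp

/-- In dimension at least three, a finite set `B` has potential of order at most `|B|^{2/d}`. -/
theorem exists_potential_le (hd : 3 ≤ d) : ∃ C : ℝ, 1 ≤ C ∧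
    ∀ (n : ℕ) (B : Finset (Fin d → ℤ)) (x : Fin d → ℤ), B.Nonempty →
      potential n B x ≤ C * (B.card : ℝ) ^ (2 / d : ℝ) := by
  have hd0 : 0 < d := by omega
  set C₁ : ℝ := (2 * Real.sqrt d) ^ d with hC₁
  have hC₁0 : 0 ≤ C₁ := by positivity
  refine ⟨3 + 2 * C₁, by linarith, fun n B x hB => ?_⟩
  have hN : (1 : ℝ) ≤ B.card := by exact_mod_cast hB.card_pos
  set r : ℝ := (B.card : ℝ) ^ (1 / d : ℝ) with hr
  have hr1 : 1 ≤ r := Real.one_le_rpow hN (by positivity)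
  have hr0 : 0 < r := by linarith
  have hrd : r ^ d = B.card := by
    rw [hr, ← Real.rpow_natCast, ← Real.rpow_mul (by positivity), one_div,
      inv_mul_cancel₀ (by positivity), Real.rpow_one]
  have hr2 : (B.card : ℝ) ^ (2 / d : ℝ) = r ^ 2 := by
    rw [hr, ← Real.rpow_natCast, ← Real.rpow_mul (by positivity)]
    congr 1
    push_cast
    ring
  -- Diffusive time scale of a ball with |B| points: up to it the trivial bound 1 is used, beyond it
  -- the heat kernel decay.
  set T : ℕ := ⌈r ^ 2⌉₊ with hT
  have hrT : r ^ 2 ≤ T := Nat.le_ceil _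
  have hTr : (T : ℝ) ≤ r ^ 2 + 1 := (Nat.ceil_lt_add_one (by positivity)).le
  have hT0 : 0 < T := Nat.ceil_pos.2 (by positivity)
  have hrsT : r ≤ Real.sqrt T := Real.le_sqrt_of_sq_le hrT
  have hdecay : ∀ k, T < k → ∑ y ∈ B, heatKernel d k (x - y) ≤
      (C₁ * r ^ 3) * (1 / Real.sqrt k) ^ 3 := by
    intro k hk
    have hk0 : 0 < k := by omega
    have hk' : (0 : ℝ) < k := by exact_mod_cast hk0
    have hrk : r ≤ Real.sqrt k :=
      hrsT.trans (Real.sqrt_le_sqrt (by exact_mod_cast hk.le))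
    have hheat : ∀ y, heatKernel d k y ≤ C₁ * (1 / Real.sqrt k) ^ d := by
      intro y
      refine (heatKernel_le hd0 hk0 y).trans_eq ?_
      rw [hC₁, ← mul_pow, Real.sqrt_div hk'.le]
      congr 1
      have : (0 : ℝ) < Real.sqrt d := Real.sqrt_pos.2 (by exact_mod_cast hd0)
      field_simp
    calc ∑ y ∈ B, heatKernel d k (x - y) ≤ ∑ _y ∈ B, C₁ * (1 / Real.sqrt k) ^ d :=
          Finset.sum_le_sum fun y _ => hheat _
      _ = C₁ * (r ^ d * (1 / Real.sqrt k) ^ d) := by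
          rw [Finset.sum_const, nsmul_eq_mul, hrd]; ring
      -- Since r ≤ √k, the surplus d - 3 powers can be dropped, leaving the summable rate k^{-3/2}.
      _ = C₁ * ((r / Real.sqrt k) ^ (d - 3) * (r / Real.sqrt k) ^ 3) := by
          rw [← pow_add, Nat.sub_add_cancel hd, ← mul_pow]; ring_nf
      _ ≤ C₁ * (1 * (r / Real.sqrt k) ^ 3) := by
          gcongr
          exact pow_le_one₀ (by positivity) (div_le_one_of_le₀ hrk (by positivity))
      _ = _ := by ring
  have hpot : potential n B x =
      ∑ k ∈ Finset.range (n + 1), ∑ y ∈ B, heatKernel d k (x - y) := by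
    rw [potential]
    simp only [green]
    rw [Finset.sum_comm]
  rw [hpot, hr2]
  refine (sum_range_le_of_decay hT0
    (fun k => Finset.sum_nonneg fun y _ => heatKernel_nonneg hd0 k _)
    (fun k => sum_heatKernel_le_one hd0 k B x) (by positivity) hdecay n).trans ?_
  have h1 : 2 * (C₁ * r ^ 3) / Real.sqrt T ≤ 2 * (C₁ * r ^ 3) / r := by gcongr
  have h2 : 2 * (C₁ * r ^ 3) / r = 2 * C₁ * r ^ 2 := by field_simp
  nlinarith

/-- Any finite set `B` contains a subset with about `|B|^{1-2/d}` points, on which its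
potential is bounded. -/
theorem exists_subset_potential_le (hd : 3 ≤ d) : ∃ C : ℝ, 1 ≤ C ∧
    ∀ (n : ℕ) (B : Finset (Fin d → ℤ)), B.Nonempty →
      ∃ A ⊆ B, A.card = ⌈(B.card : ℝ) ^ (1 - 2 / d : ℝ) / C⌉₊ ∧
        ∀ x ∈ A, potential n A x ≤ C := by
  classical
  obtain ⟨C, hC1, hC⟩ := exists_potential_le hd
  have hd0 : 0 < d := by omega
  refine ⟨2 * C, by linarith, fun n B hB => ?_⟩
  have hN : (1 : ℝ) ≤ B.card := by exact_mod_cast hB.card_pos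
  have hNe : 1 ≤ (B.card : ℝ) ^ (2 / d : ℝ) := Real.one_le_rpow hN (by positivity)
  set W : ℝ := C * (B.card : ℝ) ^ (2 / d : ℝ) with hW
  have hW1 : 1 ≤ W := by nlinarith
  set q : ℕ := ⌈W⌉₊ with hq
  have hWq : W ≤ q := Nat.le_ceil _
  have hqW : (q : ℝ) ≤ 2 * W := by
    have := (Nat.ceil_lt_add_one (a := W) (by linarith)).le
    linarith
  have hq0 : 0 < q := Nat.ceil_pos.2 (by linarith)
  -- The partition needs a zero diagonal. The self term `green d n 0` ≤ C is added back later,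
  -- giving 1 + C ≤ 2C.
  let w : B → B → ℝ := fun x y => if x = y then 0 else green d n (x.1 - y.1)
  obtain ⟨f, hf⟩ := exists_partition_weight_le w
    (fun x y => by
      simp only [w, eq_comm (a := x)]
      rw [← green_neg, neg_sub])
    (fun x => by simp [w]) hq0
  have hw : ∀ x : B, ∑ y, w x y ≤ W := by
    intro x
    calc ∑ y, w x y ≤ ∑ y : B, green d n (x.1 - y.1) := by
          refine Finset.sum_le_sum fun y _ => ?_
          simp only [w]
          split_ifs
          · exact green_nonneg hd0 _ _
          · exact le_rfl
      _ = potential n B x := Finset.sum_coe_sort B fun y => green d n (x.1 - y)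
      _ ≤ W := hC n B x hB
  have hclass : ∀ x : B, ∑ y, (if f y = f x then w x y else 0) ≤ 1 := by
    intro x
    have h := (hf x).trans ((hw x).trans hWq)
    have hq' : (0 : ℝ) < q := by exact_mod_cast hq0
    by_contra! hlt
    nlinarith
  have : Nonempty (Fin q) := ⟨⟨0, hq0⟩⟩
  -- Some class has at least |B|/q points, and q ≤ 2C|B|^{2/d}.
  obtain ⟨c, -, hc⟩ := Finset.exists_le_card_fiber_of_nsmul_le_card_of_maps_to
    (s := (Finset.univ : Finset B)) (t := (Finset.univ : Finset (Fin q))) (f := f)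
    (b := (B.card : ℝ) / q) (fun _ _ => Finset.mem_univ _) Finset.univ_nonempty (by
      have hq' : (q : ℝ) ≠ 0 := by positivity
      simp only [Finset.card_univ, Fintype.card_fin, Fintype.card_coe, nsmul_eq_mul]
      rw [mul_div_cancel₀ _ hq'])
  set A₀ : Finset (Fin d → ℤ) :=
    (Finset.univ.filter fun x : B => f x = c).map (Function.Embedding.subtype _) with hA₀
  have hA₀B : A₀ ⊆ B := by
    intro x hx
    rw [hA₀, Finset.mem_map] at hx
    obtain ⟨y, -, rfl⟩ := hx
    exact y.2
  have hgreen0 : green d n 0 ≤ C := by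
    have h := hC n {0} 0 (Finset.singleton_nonempty _)
    simpa [potential] using h
  have hpot : ∀ x ∈ A₀, potential n A₀ x ≤ 2 * C := by
    intro x hx
    rw [hA₀, Finset.mem_map] at hx
    obtain ⟨x, hxc, rfl⟩ := hx
    have hxc' : f x = c := by simpa using hxc
    have h1 : potential n A₀ x = ∑ y, if f y = f x then green d n (x.1 - y.1) else 0 := by
      rw [potential, hA₀, Finset.sum_map, Finset.sum_filter, hxc']
      rfl
    have h2 : ∑ y, (if f y = f x then green d n (x.1 - y.1) else 0) ≤
        ∑ y, ((if f y = f x then w x y else 0) + if y = x then green d n 0 else 0) := by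
      refine Finset.sum_le_sum fun y _ => ?_
      rcases eq_or_ne y x with rfl | hyx
      · simp [w]
      · simp [w, hyx, hyx.symm]
    rw [Function.Embedding.subtype_apply, h1]
    refine h2.trans ?_
    rw [Finset.sum_add_distrib, Finset.sum_ite_eq' Finset.univ x]
    simp only [Finset.mem_univ, if_true]
    linarith [hclass x]
  have hcard : ⌈(B.card : ℝ) ^ (1 - 2 / d : ℝ) / (2 * C)⌉₊ ≤ A₀.card := by
    rw [Nat.ceil_le, hA₀, Finset.card_map]
    refine le_trans ?_ hc
    rw [Real.rpow_sub (by linarith), Real.rpow_one, div_div]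
    have h0 : (0 : ℝ) < q := by exact_mod_cast hq0
    gcongr
    rw [hW] at hqW
    linarith
  -- Trimming to an exact size only lowers the potential and lets the later union bound run over
  -- sets of one fixed size.
  obtain ⟨A, hAA, hA⟩ := Finset.exists_subset_card_eq hcard
  exact ⟨A, hAA.trans hA₀B, hA, fun x hx =>
    (potential_mono_set hd0 n hAA x).trans (hpot x (hAA hx))⟩

/-! ### Feynman-Kac formula and exponential moments -/

/-- One step of the Feynman-Kac recursion with the weight `a`. -/
noncomputable def tiltedAvg (a f : (Fin d → ℤ) → ℝ) (x : Fin d → ℤ) : ℝ :=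
  a x * neighborAvg f x

/-- `1 + potential` is superharmonic for the walk weighted by `1 + 1/g` on `A`. -/
theorem iterate_tiltedAvg_le (hd : 0 < d) {N : ℕ} {A : Finset (Fin d → ℤ)} {g : ℝ} (hg : 1 ≤ g)
    (hA : ∀ x ∈ A, potential N A x ≤ g) {a : (Fin d → ℤ) → ℝ}
    (ha : a = fun x => if x ∈ A then 1 + 1 / g else 1) {n : ℕ} (hn : n ≤ N) (x : Fin d → ℤ) :
    (tiltedAvg a)^[n] a x ≤ 1 + potential n A x := by
  have hg1 : 1 / g ≤ 1 := by rw [div_le_one (by linarith)]; exact hg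
  have ha0 : ∀ x, 0 ≤ a x := by
    intro x
    rw [ha]
    dsimp only
    split_ifs <;> positivity
  induction n generalizing x with
  | zero =>
    rw [Function.iterate_zero, id, potential_zero, ha]
    dsimp only
    split_ifs <;> linarith
  | succ n ih =>
    rw [Function.iterate_succ_apply', tiltedAvg]
    have h1 : neighborAvg ((tiltedAvg a)^[n] a) x ≤ 1 + neighborAvg (potential n A) x := by
      refine (neighborAvg_mono (fun z => ih (by omega) z) x).trans_eq ?_
      rw [neighborAvg_add (fun _ => 1) (potential n A), neighborAvg_const hd]
    refine (mul_le_mul_of_nonneg_left h1 (ha0 x)).trans ?_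
    have h2 := potential_succ hd n A x
    rw [ha]
    dsimp only
    split_ifs with hx
    · rw [if_pos hx] at h2
      -- On A the potential at time n + 1 is 1 plus its neighbour average, so the weighted step
      -- yields (1 + 1/g) u with u ≤ g, which is at most u + 1.
      have h3 := (potential_mono_time hd hn A x).trans (hA x hx)
      have h4 : 1 / g * potential (n + 1) A x ≤ 1 := by
        rw [one_div, inv_mul_le_iff₀ (by linarith)]
        linarith
      have h5 : 1 + neighborAvg (potential n A) x = potential (n + 1) A x := by linarith
      rw [h5]
      linarith
    · rw [if_neg hx] at h2
      linarith

theorem lintegral_stepLaw (f : (Fin d → ℤ) → ENNReal) :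
    ∫⁻ v, f v ∂stepLaw d =
      (2 * d : ENNReal)⁻¹ * ∑ i, (f (Pi.single i 1) + f (Pi.single i (-1))) := by
  let e : Fin d × Bool → (Fin d → ℤ) := fun p => Pi.single p.1 (if p.2 then 1 else -1)
  have he : Function.Injective e := by
    rintro ⟨i, b⟩ ⟨j, c⟩ h
    have hi := congrFun h i
    rcases eq_or_ne i j with rfl | hij
    · cases b <;> cases c <;> simp [e] at hi ⊢
    · cases b <;> simp [e, hij] at hi
  have hrange : unitSteps d = ((Finset.univ.map ⟨e, he⟩ : Finset (Fin d → ℤ)) : Set _) := by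
    ext v
    simp only [unitSteps, Set.mem_ofPred_eq, Finset.coe_map, Function.Embedding.coeFn_mk,
      Finset.coe_univ, Set.image_univ, Set.mem_range, Prod.exists, Bool.exists_bool, e]
    simp only [Bool.false_eq_true, if_false, if_true]
    exact exists_congr fun i => ⟨fun h => h.symm.imp Eq.symm Eq.symm,
      fun h => (h.imp Eq.symm Eq.symm).symm⟩
  rw [stepLaw, uniformOn, ProbabilityTheory.cond, lintegral_smul_measure, hrange,
    lintegral_finset, Measure.count_apply_finset, Finset.sum_map]
  simp only [Measure.count_singleton, mul_one, Finset.card_map, Finset.card_univ,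
    Fintype.card_prod, Fintype.card_fin, Fintype.card_bool, Function.Embedding.coeFn_mk, smul_eq_mul]
  rw [Fintype.sum_prod_type]
  simp only [Fintype.sum_bool, e]
  simp [mul_comm]

theorem lintegral_stepLaw_ofReal (hd : 0 < d) {f : (Fin d → ℤ) → ℝ} (hf : ∀ x, 0 ≤ f x)
    (x : Fin d → ℤ) :
    ∫⁻ v, ENNReal.ofReal (f (x + v)) ∂stepLaw d = ENNReal.ofReal (neighborAvg f x) := by
  rw [lintegral_stepLaw, neighborAvg, ENNReal.ofReal_mul (by positivity),
    ENNReal.ofReal_inv_of_pos (by positivity), ENNReal.ofReal_mul (by norm_num),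
    ENNReal.ofReal_sum_of_nonneg fun i _ => add_nonneg (hf _) (hf _)]
  simp only [ENNReal.ofReal_add (hf _) (hf _)]
  simp

theorem walk_succ (ω : ℕ → Fin d → ℤ) (n : ℕ) : walk ω (n + 1) = walk ω n + ω n :=
  Finset.sum_range_succ _ _

theorem measurable_walk (k : ℕ) : Measurable fun ω : ℕ → Fin d → ℤ => walk ω k := by
  unfold walk
  fun_prop

theorem indepFun_past_step (hd : 0 < d) (n : ℕ) :
    IndepFun (fun (ω : ℕ → Fin d → ℤ) (i : Finset.range n) => ω i) (fun ω => ω n)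
      (walkMeasure d) := by
  have := isProbabilityMeasure_stepLaw hd
  have hind : iIndepFun (fun (i : ℕ) (ω : ℕ → Fin d → ℤ) => ω i) (walkMeasure d) :=
    iIndepFun_infinitePi (P := fun _ : ℕ => stepLaw d) (X := fun _ v => v)
      fun _ => measurable_id
  have h := hind.indepFun_finset (Finset.range n) {n} (by simp)
    fun i => measurable_pi_apply i
  have hψ : Measurable fun v : ({n} : Finset ℕ) → Fin d → ℤ =>
      v ⟨n, Finset.mem_singleton_self n⟩ := measurable_pi_apply _
  exact h.comp measurable_id hψ

theorem map_step (hd : 0 < d) (n : ℕ) :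
    (walkMeasure d).map (fun ω => ω n) = stepLaw d := by
  have := isProbabilityMeasure_stepLaw hd
  exact (measurePreserving_eval_infinitePi (fun _ : ℕ => stepLaw d) n).map_eq

theorem lintegral_past_step (hd : 0 < d) (n : ℕ)
    (F : (Finset.range n → Fin d → ℤ) → (Fin d → ℤ) → ENNReal) :
    ∫⁻ ω, F (fun i => ω i) (ω n) ∂walkMeasure d =
      ∫⁻ ω, ∫⁻ v, F (fun i => ω i) v ∂stepLaw d ∂walkMeasure d := by
  have := isProbabilityMeasure_stepLaw hd
  have := isProbabilityMeasure_walkMeasure hd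
  have hX : Measurable fun (ω : ℕ → Fin d → ℤ) (i : Finset.range n) => ω i := by fun_prop
  have hY : Measurable fun ω : ℕ → Fin d → ℤ => ω n := by fun_prop
  have hF : Measurable (Function.uncurry F) := Measurable.of_discrete
  have hprod := (indepFun_iff_map_prod_eq_prod_map_map hX.aemeasurable hY.aemeasurable).1
    (indepFun_past_step hd n)
  calc ∫⁻ ω, F (fun i => ω i) (ω n) ∂walkMeasure d
      = ∫⁻ p, Function.uncurry F p ∂(walkMeasure d).map
          (fun ω => ((fun i : Finset.range n => ω i), ω n)) :=
        (lintegral_map hF (hX.prodMk hY)).symm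
    _ = ∫⁻ ξ, ∫⁻ v, F ξ v ∂stepLaw d ∂(walkMeasure d).map
          (fun ω (i : Finset.range n) => ω i) := by
        rw [hprod, map_step hd, lintegral_prod _ hF.aemeasurable]
        rfl
    _ = _ := lintegral_map Measurable.of_discrete hX

/-- Markov property at time n: the weights up to time n depend only on the first n increments, so
the next one can be averaged out separately. -/
theorem lintegral_walk_step (hd : 0 < d) {a f : (Fin d → ℤ) → ℝ} (ha : ∀ x, 0 ≤ a x)
    (hf : ∀ x, 0 ≤ f x) (n : ℕ) :
    ∫⁻ ω, ENNReal.ofReal ((∏ k ∈ Finset.range (n + 1), a (walk ω k)) * f (walk ω (n + 1)))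
        ∂walkMeasure d =
      ∫⁻ ω, ENNReal.ofReal ((∏ k ∈ Finset.range (n + 1), a (walk ω k)) *
        neighborAvg f (walk ω n)) ∂walkMeasure d := by
  -- Padding with zeros is harmless, as positions up to time n read only increments with index below
  -- n.
  let ext : (Finset.range n → Fin d → ℤ) → ℕ → Fin d → ℤ :=
    fun ξ i => if h : i ∈ Finset.range n then ξ ⟨i, h⟩ else 0
  have hext : ∀ (ω : ℕ → Fin d → ℤ) (k : ℕ), k ≤ n →
      walk (ext fun i => ω i) k = walk ω k := by
    intro ω k hk
    refine Finset.sum_congr rfl fun i hi => ?_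
    exact dif_pos (Finset.mem_range.2 ((Finset.mem_range.1 hi).trans_le hk))
  have hprod : ∀ ω : ℕ → Fin d → ℤ,
      ∏ k ∈ Finset.range (n + 1), a (walk (ext fun i => ω i) k) =
        ∏ k ∈ Finset.range (n + 1), a (walk ω k) := fun ω =>
    Finset.prod_congr rfl fun k hk => by
      rw [hext ω k (by simpa [Nat.lt_succ_iff] using hk)]
  have h := lintegral_past_step hd n fun ξ v =>
    ENNReal.ofReal ((∏ k ∈ Finset.range (n + 1), a (walk (ext ξ) k)) * f (walk (ext ξ) n + v))
  simp only [hprod, hext _ n le_rfl, ← walk_succ] at h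
  rw [h]
  refine lintegral_congr fun ω => ?_
  have hp : 0 ≤ ∏ k ∈ Finset.range (n + 1), a (walk ω k) := Finset.prod_nonneg fun k _ => ha _
  simp only [ENNReal.ofReal_mul hp]
  rw [lintegral_const_mul _ Measurable.of_discrete, lintegral_stepLaw_ofReal hd hf]

theorem neighborAvg_nonneg {f : (Fin d → ℤ) → ℝ} (hf : ∀ x, 0 ≤ f x) (x : Fin d → ℤ) :
    0 ≤ neighborAvg f x :=
  mul_nonneg (by positivity) (Finset.sum_nonneg fun _ _ => add_nonneg (hf _) (hf _))

/-- The Feynman-Kac formula for the walk. -/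
theorem lintegral_prod_walk (hd : 0 < d) {a : (Fin d → ℤ) → ℝ} (ha : ∀ x, 0 ≤ a x) (n : ℕ)
    {f : (Fin d → ℤ) → ℝ} (hf : ∀ x, 0 ≤ f x) :
    ∫⁻ ω, ENNReal.ofReal ((∏ k ∈ Finset.range (n + 1), a (walk ω k)) * f (walk ω n))
        ∂walkMeasure d =
      ENNReal.ofReal ((tiltedAvg a)^[n] (fun x => a x * f x) 0) := by
  have := isProbabilityMeasure_walkMeasure hd
  induction n generalizing f with
  | zero => simp [walk]
  | succ n ih =>
    have haf : ∀ x, 0 ≤ a x * f x := fun x => mul_nonneg (ha x) (hf x)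
    have h := lintegral_walk_step hd ha haf n
    simp only [Finset.prod_range_succ _ (n + 1), mul_assoc] at h ⊢
    rw [h, ih (neighborAvg_nonneg haf), Function.iterate_succ_apply]
    rfl

theorem sum_localTime (ω : ℕ → Fin d → ℤ) (n : ℕ) (A : Finset (Fin d → ℤ)) :
    ∑ x ∈ A, localTime ω n x =
      ∑ k ∈ Finset.range (n + 1), if walk ω k ∈ A then 1 else 0 := by
  simp only [localTime]
  rw [Finset.sum_comm]
  simp

/-- If the potential of `A` is at most `g` on `A`, the probability that all local times on `A`
are at least `m` decays exponentially in `m |A| / g`. -/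
theorem measure_forall_le_localTime_le (hd : 0 < d) {n : ℕ} {A : Finset (Fin d → ℤ)} {g : ℝ}
    (hg : 1 ≤ g) (hA : ∀ x ∈ A, potential n A x ≤ g) (m : ℝ) :
    (walkMeasure d).real {ω | ∀ x ∈ A, m ≤ (localTime ω n x : ℝ)} ≤
      (n + 2) * Real.exp (-(Real.log (1 + 1 / g) * (A.card * m))) := by
  have := isProbabilityMeasure_walkMeasure hd
  have hg0 : 0 < g := by linarith
  set lam := Real.log (1 + 1 / g) with hlam
  have h1g : 1 ≤ 1 + 1 / g := by linarith [show 0 < 1 / g by positivity]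
  have hlam0 : 0 ≤ lam := Real.log_nonneg h1g
  set a : (Fin d → ℤ) → ℝ := fun x => if x ∈ A then 1 + 1 / g else 1 with ha
  have ha0 : ∀ x, 0 ≤ a x := fun x => by
    simp only [ha]
    split_ifs <;> positivity
  have hprod : ∀ ω : ℕ → Fin d → ℤ, ∏ k ∈ Finset.range (n + 1), a (walk ω k) =
      Real.exp (lam * ∑ x ∈ A, (localTime ω n x : ℝ)) := by
    intro ω
    rw [← Nat.cast_sum, sum_localTime, Nat.cast_sum, Finset.mul_sum, Real.exp_sum]
    refine Finset.prod_congr rfl fun k _ => ?_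
    simp only [ha]
    split_ifs
    · rw [Nat.cast_one, mul_one, hlam, Real.exp_log (by linarith)]
    · simp
  have hint := lintegral_prod_walk hd ha0 n (f := fun _ => 1) fun _ => zero_le_one
  simp only [mul_one] at hint
  -- The origin may lie outside A, where g is no bound; the trivial bound n + 1 on the potential is
  -- used instead.
  have hle : (tiltedAvg a)^[n] a 0 ≤ n + 2 := by
    have h1 := iterate_tiltedAvg_le hd hg hA ha le_rfl 0
    linarith [potential_le_time hd n A 0]
  set t : ℝ := Real.exp (lam * (A.card * m)) with ht
  have ht0 : 0 < t := Real.exp_pos _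
  have hmeas : Measurable fun ω : ℕ → Fin d → ℤ =>
      ENNReal.ofReal (∏ k ∈ Finset.range (n + 1), a (walk ω k)) := by
    refine ENNReal.measurable_ofReal.comp (Finset.measurable_prod _ fun k _ => ?_)
    exact (Measurable.of_discrete (f := a)).comp (measurable_walk k)
  have hmarkov := mul_meas_ge_le_lintegral (μ := walkMeasure d) hmeas (ENNReal.ofReal t)
  rw [hint] at hmarkov
  have hsub : {ω | ∀ x ∈ A, m ≤ (localTime ω n x : ℝ)} ⊆ {ω : ℕ → Fin d → ℤ |
      ENNReal.ofReal t ≤ ENNReal.ofReal (∏ k ∈ Finset.range (n + 1), a (walk ω k))} := by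
    intro ω hω
    refine ENNReal.ofReal_le_ofReal ?_
    rw [hprod, ht]
    refine Real.exp_le_exp.2 (mul_le_mul_of_nonneg_left ?_ hlam0)
    calc (A.card : ℝ) * m = ∑ _x ∈ A, m := by simp
      _ ≤ _ := Finset.sum_le_sum hω
  have hfin : t * (walkMeasure d).real {ω | ∀ x ∈ A, m ≤ (localTime ω n x : ℝ)} ≤ n + 2 := by
    have h1 : ENNReal.ofReal t * (walkMeasure d) {ω | ∀ x ∈ A, m ≤ (localTime ω n x : ℝ)} ≤
        ENNReal.ofReal (n + 2) :=
      (mul_le_mul_right (measure_mono hsub) _).trans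
        (hmarkov.trans (ENNReal.ofReal_le_ofReal hle))
    have h2 := ENNReal.toReal_mono ENNReal.ofReal_ne_top h1
    rwa [ENNReal.toReal_mul, ENNReal.toReal_ofReal ht0.le,
      ENNReal.toReal_ofReal (by positivity)] at h2
  rw [Real.exp_neg, ← ht, ← div_eq_mul_inv, le_div_iff₀ ht0]
  linarith

/-! ### Number of sites with large local time -/

theorem ae_forall_mem_unitSteps (hd : 0 < d) :
    ∀ᵐ ω ∂walkMeasure d, ∀ i, ω i ∈ unitSteps d := by
  rw [ae_all_iff]
  intro i
  have hm : MeasurableSet (unitSteps d) := (unitSteps_finite d).measurableSet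
  have h : ∀ᵐ v ∂stepLaw d, v ∈ unitSteps d := by
    rw [stepLaw, uniformOn]
    exact ae_cond_mem hm
  rw [← map_step hd i] at h
  exact ae_of_ae_map (measurable_pi_apply i).aemeasurable h

/-- The cube `[-n, n]^d`. -/
noncomputable def cube (d n : ℕ) : Finset (Fin d → ℤ) :=
  Fintype.piFinset fun _ => Finset.Icc (-(n : ℤ)) n

theorem card_cube (d n : ℕ) : (cube d n).card = (2 * n + 1) ^ d := by
  have : ((n : ℤ) + 1 + n).toNat = 2 * n + 1 := by omega
  simp [cube, Int.card_Icc, this]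

theorem abs_walk_le {ω : ℕ → Fin d → ℤ} (hω : ∀ i, ω i ∈ unitSteps d) (k : ℕ) (j : Fin d) :
    |walk ω k j| ≤ k := by
  induction k with
  | zero => simp [walk]
  | succ k ih =>
    rw [walk_succ, Pi.add_apply]
    have h1 : |ω k j| ≤ 1 := by
      obtain ⟨i, h | h⟩ := hω k <;> rw [h] <;> rcases eq_or_ne j i with rfl | hij <;> simp [*]
    push_cast
    exact (abs_add_le _ _).trans (add_le_add ih h1)

theorem exists_walk_eq {ω : ℕ → Fin d → ℤ} {n : ℕ} {x : Fin d → ℤ}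
    (h : 0 < localTime ω n x) : ∃ k ≤ n, walk ω k = x := by
  by_contra! hne
  refine h.ne' (Finset.sum_eq_zero fun k hk => if_neg (hne k ?_))
  simpa [Nat.lt_succ_iff] using hk

theorem finite_le_localTime (ω : ℕ → Fin d → ℤ) (n : ℕ) {m : ℝ} (hm : 0 < m) :
    {x | m ≤ (localTime ω n x : ℝ)}.Finite := by
  refine ((Finset.range (n + 1)).image (walk ω)).finite_toSet.subset fun x hx => ?_
  obtain ⟨k, hk, rfl⟩ := exists_walk_eq (n := n) (x := x) (ω := ω)
    (by exact_mod_cast hm.trans_le hx)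
  simpa using ⟨k, by omega, rfl⟩

theorem mem_cube_of_localTime_pos {ω : ℕ → Fin d → ℤ} (hω : ∀ i, ω i ∈ unitSteps d) {n : ℕ}
    {x : Fin d → ℤ} (h : 0 < localTime ω n x) : x ∈ cube d n := by
  obtain ⟨k, hk, rfl⟩ := exists_walk_eq h
  rw [cube, Fintype.mem_piFinset]
  intro j
  have := abs_le.1 (abs_walk_le hω k j)
  have hk' : (k : ℤ) ≤ n := by exact_mod_cast hk
  rw [Finset.mem_Icc]
  omega

/-- The union bound over well spread subsets of the level set. -/
theorem exists_measure_le_ncard_le (hd : 3 ≤ d) : ∃ c : ℝ, 0 < c ∧ ∃ C : ℝ, 1 ≤ C ∧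
    ∀ (n : ℕ) (m K : ℝ), 0 < m → 0 < K → ∃ k : ℕ, 0 < k ∧ K ^ (1 - 2 / d : ℝ) / C ≤ k ∧
      (walkMeasure d).real {ω | K ≤ ({x | m ≤ (localTime ω n x : ℝ)}.ncard : ℝ)} ≤
        ((2 * n + 1) ^ d) ^ k * ((n + 2) * Real.exp (-(c * (k * m)))) := by
  classical
  have hd0 : 0 < d := by omega
  have := isProbabilityMeasure_walkMeasure hd0
  obtain ⟨C, hC1, hC⟩ := exists_subset_potential_le hd
  refine ⟨Real.log (1 + 1 / C), Real.log_pos (by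
    linarith [show 0 < 1 / C by positivity]), C, hC1, fun n m K hm hK => ?_⟩
  have hexp : (0 : ℝ) ≤ 1 - 2 / d := by
    rw [sub_nonneg, div_le_one (by positivity)]
    exact_mod_cast (by omega : 2 ≤ d)
  have hceil : 0 < ⌈K⌉₊ := Nat.ceil_pos.2 hK
  have hceil' : (0 : ℝ) < ⌈K⌉₊ := by exact_mod_cast hceil
  set k : ℕ := ⌈((⌈K⌉₊ : ℕ) : ℝ) ^ (1 - 2 / d : ℝ) / C⌉₊ with hk
  refine ⟨k, Nat.ceil_pos.2 (by positivity), ?_, ?_⟩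
  · refine le_trans ?_ (Nat.le_ceil _)
    gcongr
    exact Nat.le_ceil K
  set S := ((cube d n).powersetCard k).filter fun A => ∀ x ∈ A, potential n A x ≤ C with hS
  have hsub : ∀ᵐ ω ∂walkMeasure d,
      K ≤ ({x | m ≤ (localTime ω n x : ℝ)}.ncard : ℝ) →
        ω ∈ ⋃ A ∈ S, {ω | ∀ x ∈ A, m ≤ (localTime ω n x : ℝ)} := by
    filter_upwards [ae_forall_mem_unitSteps hd0] with ω hω hcard
    have hfin := finite_le_localTime ω n hm
    rw [Set.ncard_eq_toFinset_card _ hfin, ← Nat.ceil_le] at hcard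
    -- Taking exactly ⌈K⌉ sites makes the size k of the spread subset deterministic.
    obtain ⟨B, hB, hBcard⟩ := Finset.exists_subset_card_eq hcard
    obtain ⟨A, hAB, hA, hpot⟩ := hC n B (Finset.card_pos.1 (by omega))
    have hmem : ∀ x ∈ A, m ≤ (localTime ω n x : ℝ) := fun x hx =>
      hfin.mem_toFinset.1 (hB (hAB hx))
    simp only [Set.mem_iUnion]
    refine ⟨A, ?_, hmem⟩
    rw [hS, Finset.mem_filter, Finset.mem_powersetCard]
    exact ⟨⟨fun x hx => mem_cube_of_localTime_pos hω
      (by exact_mod_cast hm.trans_le (hmem x hx)), by rw [hA, hBcard]⟩, hpot⟩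
  calc (walkMeasure d).real {ω | K ≤ ({x | m ≤ (localTime ω n x : ℝ)}.ncard : ℝ)}
      ≤ (walkMeasure d).real (⋃ A ∈ S, {ω | ∀ x ∈ A, m ≤ (localTime ω n x : ℝ)}) :=
        ENNReal.toReal_mono (measure_ne_top _ _) (measure_mono_ae hsub)
    _ ≤ ∑ A ∈ S, (walkMeasure d).real {ω | ∀ x ∈ A, m ≤ (localTime ω n x : ℝ)} :=
        measureReal_biUnion_finset_le _ _
    _ ≤ ∑ _A ∈ S, (n + 2) * Real.exp (-(Real.log (1 + 1 / C) * (k * m))) := by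
        refine Finset.sum_le_sum fun A hA => ?_
        rw [hS, Finset.mem_filter, Finset.mem_powersetCard] at hA
        have h := measure_forall_le_localTime_le hd0 hC1 hA.2 m
        rwa [hA.1.2] at h
    _ = S.card * ((n + 2) * Real.exp (-(Real.log (1 + 1 / C) * (k * m)))) := by
        rw [Finset.sum_const, nsmul_eq_mul]
    _ ≤ _ := by
        gcongr
        have h1 : S.card ≤ ((2 * n + 1) ^ d) ^ k := by
          refine (Finset.card_filter_le _ _).trans ?_
          rw [Finset.card_powersetCard, card_cube]
          exact Nat.choose_le_pow _ _
        exact_mod_cast h1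

/-- In dimension at least three, the number of sites visited at least `n^β` times exceeds `K`
with probability at most `exp (-c K^{1-2/d} n^β)`. -/
theorem exists_eventually_measure_le_ncard_le (hd : 3 ≤ d) : ∃ c : ℝ, 0 < c ∧
    ∀ β : ℝ, 0 < β → ∀ᶠ n : ℕ in atTop, ∀ K : ℝ, 0 < K →
      (walkMeasure d).real
          {ω | K ≤ ({x | (n : ℝ) ^ β ≤ (localTime ω n x : ℝ)}.ncard : ℝ)} ≤
        Real.exp (-(c * (K ^ (1 - 2 / d : ℝ) * (n : ℝ) ^ β))) := by
  obtain ⟨c, hc, C, hC1, h⟩ := exists_measure_le_ncard_le hd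
  have hC0 : 0 < C := by linarith
  refine ⟨c / 2 / C, by positivity, fun β hβ => ?_⟩
  -- The entropy per chosen site is polynomial in n and uses up half of the rate c.
  have hpoly : ∀ᶠ n : ℕ in atTop,
      ((2 * n + 1 : ℝ) ^ d * (n + 2)) ≤ Real.exp (c / 2 * (n : ℝ) ^ β) := by
    have hlog : ∀ᶠ n : ℕ in atTop, Real.log n ≤ (c / 2 / (2 * (d + 1))) * (n : ℝ) ^ β := by
      have hpos : 0 < c / 2 / (2 * (d + 1)) := by positivity
      have := ((isLittleO_log_rpow_atTop hβ).bound hpos).filter_mono le_rfl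
      have := tendsto_natCast_atTop_atTop.eventually this
      filter_upwards [this, eventually_ge_atTop 1] with n hn hn1
      rw [Real.norm_eq_abs, Real.norm_eq_abs] at hn
      have h2 : |(n : ℝ) ^ β| = (n : ℝ) ^ β := abs_of_nonneg (by positivity)
      rw [h2] at hn
      exact (le_abs_self _).trans hn
    filter_upwards [hlog, eventually_ge_atTop 3] with n hn hn3
    have hn3' : (3 : ℝ) ≤ n := by exact_mod_cast hn3
    have hn0 : (0 : ℝ) < n := by linarith
    calc ((2 * n + 1 : ℝ) ^ d * (n + 2)) ≤ ((n : ℝ) ^ 2) ^ d * (n : ℝ) ^ 2 := by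
          gcongr <;> nlinarith
      _ = (n : ℝ) ^ (2 * (d + 1)) := by ring
      _ = Real.exp ((2 * (d + 1)) * Real.log n) := by
          rw [← Real.exp_log hn0, ← Real.exp_nat_mul, Real.log_exp]
          push_cast
          ring_nf
      _ ≤ _ := by
          apply Real.exp_le_exp.2
          calc (2 * (d + 1) : ℝ) * Real.log n
              ≤ (2 * (d + 1)) * ((c / 2 / (2 * (d + 1))) * (n : ℝ) ^ β) := by gcongr
            _ = _ := by field_simp
  filter_upwards [hpoly] with n hn K hK
  rcases Nat.eq_zero_or_pos n with rfl | hn0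
  · have := isProbabilityMeasure_walkMeasure (d := d) (by omega)
    simp only [Nat.cast_zero, Real.zero_rpow hβ.ne', mul_zero, neg_zero, Real.exp_zero]
    exact measureReal_le_one
  have hn0' : (0 : ℝ) < n := by exact_mod_cast hn0
  obtain ⟨k, hk0, hk, hle⟩ := h n ((n : ℝ) ^ β) K (by positivity) hK
  refine hle.trans ?_
  -- The single prefactor is also charged once per site, so that everything is a k-th power.
  have h2 : (n + 2 : ℝ) ≤ (n + 2) ^ k := le_self_pow₀ (by linarith) hk0.ne'
  calc ((2 * n + 1 : ℝ) ^ d) ^ k * ((n + 2) * Real.exp (-(c * (k * (n : ℝ) ^ β))))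
      ≤ ((2 * n + 1 : ℝ) ^ d) ^ k * ((n + 2) ^ k * Real.exp (-(c * (k * (n : ℝ) ^ β)))) := by
        gcongr
    _ = ((2 * n + 1 : ℝ) ^ d * (n + 2)) ^ k * Real.exp (-(c * (k * (n : ℝ) ^ β))) := by
        rw [mul_pow]; ring
    _ ≤ Real.exp (c / 2 * (n : ℝ) ^ β) ^ k * Real.exp (-(c * (k * (n : ℝ) ^ β))) := by
        gcongr
    _ = Real.exp (-(c / 2 * (k * (n : ℝ) ^ β))) := by
        rw [← Real.exp_nat_mul, ← Real.exp_add]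
        congr 1
        ring
    _ ≤ _ := by
        apply Real.exp_le_exp.2
        apply neg_le_neg
        calc c / 2 / C * (K ^ (1 - 2 / d : ℝ) * (n : ℝ) ^ β)
            = c / 2 * (K ^ (1 - 2 / d : ℝ) / C * (n : ℝ) ^ β) := by ring
          _ ≤ _ := by gcongr

/-! ### Slicing the level set -/

theorem exists_step_mem_Icc {u : ℕ → ℝ} {t : ℝ} {N : ℕ} (hN : 0 < N) (h0 : u 0 ≤ t)
    (h1 : t ≤ u N) : ∃ i < N, u i ≤ t ∧ t ≤ u (i + 1) := by
  induction N with
  | zero => omega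
  | succ N ih =>
    by_cases h : u N ≤ t
    · exact ⟨N, by omega, h, h1⟩
    · rcases Nat.eq_zero_or_pos N with rfl | hN'
      · exact absurd h0 h
      · obtain ⟨i, hi, h2⟩ := ih hN' (not_le.1 h).le
        exact ⟨i, by omega, h2⟩

/-- A site in slice i contributes at most the p-th power of the upper level, and is counted among
all sites above the lower level. -/
theorem levelPowerSum_le_sum_ncard (ω : ℕ → Fin d → ℤ) {n N : ℕ} (hn : 0 < n) (hN : 0 < N)
    {p : ℝ} (hp : 0 ≤ p) (β : ℕ → ℝ) :
    levelPowerSum ω n (β 0) (β N) p ≤ ∑ i ∈ Finset.range N,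
      ({x | (n : ℝ) ^ β i ≤ (localTime ω n x : ℝ)}.ncard : ℝ) * (n : ℝ) ^ (p * β (i + 1)) := by
  classical
  have hn' : (0 : ℝ) < n := by exact_mod_cast hn
  have hfin : ∀ c : ℝ, {x | (n : ℝ) ^ c ≤ (localTime ω n x : ℝ)}.Finite := fun c =>
    finite_le_localTime ω n (by positivity)
  have hD : (levelSet ω n (β 0) (β N)).Finite := (hfin (β 0)).subset fun x hx => hx.1
  rw [levelPowerSum, finsum_mem_eq_finite_toFinset_sum _ hD]
  calc ∑ x ∈ hD.toFinset, (localTime ω n x : ℝ) ^ p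
      ≤ ∑ x ∈ hD.toFinset, ∑ i ∈ Finset.range N,
          if (n : ℝ) ^ β i ≤ (localTime ω n x : ℝ) then (n : ℝ) ^ (p * β (i + 1)) else 0 := by
        refine Finset.sum_le_sum fun x hx => ?_
        rw [Set.Finite.mem_toFinset] at hx
        obtain ⟨i, hi, h1, h2⟩ := exists_step_mem_Icc (u := fun i => (n : ℝ) ^ β i) hN hx.1 hx.2
        calc (localTime ω n x : ℝ) ^ p ≤ ((n : ℝ) ^ β (i + 1)) ^ p := by gcongr
          _ = if (n : ℝ) ^ β i ≤ (localTime ω n x : ℝ) then (n : ℝ) ^ (p * β (i + 1)) else 0 := by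
            rw [if_pos h1, ← Real.rpow_mul hn'.le, mul_comm]
          _ ≤ _ := Finset.single_le_sum (f := fun i =>
              if (n : ℝ) ^ β i ≤ (localTime ω n x : ℝ) then (n : ℝ) ^ (p * β (i + 1)) else 0)
            (fun j _ => by split_ifs <;> positivity) (Finset.mem_range.2 hi)
    _ = ∑ i ∈ Finset.range N,
          ((hD.toFinset.filter fun x => (n : ℝ) ^ β i ≤ (localTime ω n x : ℝ)).card : ℝ) *
            (n : ℝ) ^ (p * β (i + 1)) := by
        rw [Finset.sum_comm]
        refine Finset.sum_congr rfl fun i _ => ?_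
        rw [← Finset.sum_filter, Finset.sum_const, nsmul_eq_mul]
    _ ≤ _ := by
        refine Finset.sum_le_sum fun i _ => ?_
        gcongr
        rw [Set.ncard_eq_toFinset_card _ (hfin (β i))]
        refine Finset.card_le_card fun x hx => ?_
        rw [Finset.mem_filter] at hx
        exact (hfin (β i)).mem_toFinset.2 hx.2

/-- The tail of `∑ l_n(x)^p` over a level set, in dimension at least three, when the exponent
condition holds at both ends of the range of levels. -/
theorem eventually_measure_levelPowerSum_le (hd : 3 ≤ d) {a b γ ζ p y : ℝ} (hb0 : 0 < b)
    (hζ : 0 < ζ) (hp : 0 < p) (hy : 0 < y) (hba : b < a)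
    (ha : ζ < γ - a * (p - 1) - 2 / (d : ℝ) * (γ - a * p))
    (hb : ζ < γ - b * (p - 1) - 2 / (d : ℝ) * (γ - b * p)) :
    ∀ᶠ n : ℕ in atTop, (walkMeasure d).real {ω | (n : ℝ) ^ γ * y ≤ levelPowerSum ω n b a p} ≤
      Real.exp (-(n : ℝ) ^ ζ) := by
  have := isProbabilityMeasure_walkMeasure (d := d) (by omega)
  obtain ⟨c, hc, hbound⟩ := exists_eventually_measure_le_ncard_le hd
  set κ : ℝ := 1 - 2 / d with hκ
  have hκ0 : 0 ≤ κ := by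
    rw [hκ, sub_nonneg, div_le_one (by positivity)]
    exact_mod_cast (by omega : 2 ≤ d)
  have hκ1 : κ ≤ 1 := by rw [hκ]; linarith [show (0 : ℝ) ≤ 2 / d by positivity]
  have ha' : ζ < (γ - p * a) * κ + a := by rw [hκ]; linarith
  have hb' : ζ < (γ - p * b) * κ + b := by rw [hκ]; linarith
  obtain ⟨δ, hδ, hδa, hδb⟩ : ∃ δ > 0, ζ + 2 * δ ≤ (γ - p * a) * κ + a ∧
      ζ + 2 * δ ≤ (γ - p * b) * κ + b :=
    ⟨min ((γ - p * a) * κ + a - ζ) ((γ - p * b) * κ + b - ζ) / 2,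
      half_pos (lt_min (by linarith) (by linarith)),
      by linarith [min_le_left ((γ - p * a) * κ + a - ζ) ((γ - p * b) * κ + b - ζ)],
      by linarith [min_le_right ((γ - p * a) * κ + a - ζ) ((γ - p * b) * κ + b - ζ)]⟩
  -- Using opposite ends of a slice for size and count loses pηκ in the exponent; this N keeps the
  -- loss below δ, half of the available margin 2δ.
  obtain ⟨N, hN⟩ := exists_nat_gt (p * (a - b) / δ)
  have hN0' : (0 : ℝ) < N :=
    (div_pos (mul_pos hp (by linarith)) hδ).trans hN
  have hN0 : 0 < N := by exact_mod_cast hN0'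
  set η : ℝ := (a - b) / N with hη
  have hη0 : 0 < η := div_pos (by linarith) hN0'
  have hηδ : p * η ≤ δ := by
    rw [hη, mul_div_assoc', div_le_iff₀ hN0']
    rw [div_lt_iff₀ hδ] at hN
    linarith
  have hNη : N * η = a - b := by rw [hη]; field_simp
  set β : ℕ → ℝ := fun i => b + i * η with hβ
  have hβ0 : β 0 = b := by simp [hβ]
  have hβN : β N = a := by simp only [hβ]; linarith
  have hβpos : ∀ i, 0 < β i := fun i => by simp only [hβ]; positivity
  have hexp : ∀ i < N, ζ + δ ≤ (γ - p * β (i + 1)) * κ + β i := by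
    intro i hi
    have hiN : (i : ℝ) ≤ N := by exact_mod_cast hi.le
    have haff : N * ((γ - p * β i) * κ + β i) =
        (N - i) * ((γ - p * b) * κ + b) + i * ((γ - p * a) * κ + a) := by
      have : a = b + N * η := by linarith
      rw [this]
      simp only [hβ]
      ring
    have h1 : N * (ζ + 2 * δ) ≤ N * ((γ - p * β i) * κ + β i) := by
      rw [haff]
      have e1 := mul_le_mul_of_nonneg_left hδb (sub_nonneg.2 hiN)
      have e2 := mul_le_mul_of_nonneg_left hδa (Nat.cast_nonneg (α := ℝ) i)
      linarith
    have h2 := le_of_mul_le_mul_left h1 hN0'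
    have h3 : (γ - p * β (i + 1)) * κ + β i = (γ - p * β i) * κ + β i - p * η * κ := by
      simp only [hβ]
      push_cast
      ring
    have h4 : p * η * κ ≤ p * η := mul_le_of_le_one_right (by positivity) hκ1
    linarith
  set c' : ℝ := c * (y / N) ^ κ with hc'
  have hc'0 : 0 < c' := by positivity
  have hall : ∀ᶠ n : ℕ in atTop, ∀ i ∈ Finset.range N, ∀ K : ℝ, 0 < K →
      (walkMeasure d).real
          {ω | K ≤ ({x | (n : ℝ) ^ β i ≤ (localTime ω n x : ℝ)}.ncard : ℝ)} ≤
        Real.exp (-(c * (K ^ κ * (n : ℝ) ^ β i))) :=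
    (Filter.eventually_all_finset _).2 fun i _ => hbound (β i) (hβpos i)
  -- The remaining factor n^δ absorbs both c' and the N terms of the union bound, which leaves the
  -- constant 1 before n^ζ.
  have hlarge : ∀ᶠ n : ℕ in atTop, (1 + Real.log N) / c' ≤ (n : ℝ) ^ δ :=
    ((tendsto_rpow_atTop hδ).comp tendsto_natCast_atTop_atTop).eventually_ge_atTop _
  filter_upwards [hall, hlarge, eventually_ge_atTop 1] with n hn hnl hn1
  have hn1' : (1 : ℝ) ≤ n := by exact_mod_cast hn1
  have hn0 : (0 : ℝ) < n := by linarith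
  -- The count at which slice i alone could supply the share n^γ y / N of the sum.
  set K : ℕ → ℝ := fun i => (n : ℝ) ^ (γ - p * β (i + 1)) * (y / N) with hK
  have hK0 : ∀ i, 0 < K i := fun i => by simp only [hK]; positivity
  have hsub : {ω | (n : ℝ) ^ γ * y ≤ levelPowerSum ω n b a p} ⊆ ⋃ i ∈ Finset.range N,
      {ω : ℕ → Fin d → ℤ |
        K i ≤ ({x | (n : ℝ) ^ β i ≤ (localTime ω n x : ℝ)}.ncard : ℝ)} := by
    intro ω hω
    by_contra hnot
    simp only [Set.mem_iUnion, Set.mem_ofPred_eq, not_exists, not_le] at hnot hω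
    have h1 := levelPowerSum_le_sum_ncard ω hn1 hN0 hp.le β
    rw [hβ0, hβN] at h1
    have h2 : ∑ i ∈ Finset.range N, ({x | (n : ℝ) ^ β i ≤ (localTime ω n x : ℝ)}.ncard : ℝ) *
        (n : ℝ) ^ (p * β (i + 1)) < ∑ i ∈ Finset.range N, K i * (n : ℝ) ^ (p * β (i + 1)) :=
      Finset.sum_lt_sum_of_nonempty (Finset.nonempty_range_iff.2 hN0.ne') fun i hi =>
        mul_lt_mul_of_pos_right (hnot i hi) (by positivity)
    have h3 : ∀ i, K i * (n : ℝ) ^ (p * β (i + 1)) = (n : ℝ) ^ γ * (y / N) := by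
      intro i
      simp only [hK]
      rw [mul_right_comm, ← Real.rpow_add hn0, sub_add_cancel]
    simp only [h3, Finset.sum_const, Finset.card_range, nsmul_eq_mul] at h2
    have h4 : N * ((n : ℝ) ^ γ * (y / N)) = (n : ℝ) ^ γ * y := by field_simp
    linarith
  have hterm : ∀ i ∈ Finset.range N, (walkMeasure d).real
      {ω | K i ≤ ({x | (n : ℝ) ^ β i ≤ (localTime ω n x : ℝ)}.ncard : ℝ)} ≤
        Real.exp (-(c' * (n : ℝ) ^ (ζ + δ))) := by
    intro i hi
    refine (hn i hi (K i) (hK0 i)).trans (Real.exp_le_exp.2 (neg_le_neg ?_))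
    have e : K i ^ κ * (n : ℝ) ^ β i =
        (y / N) ^ κ * (n : ℝ) ^ ((γ - p * β (i + 1)) * κ + β i) := by
      simp only [hK]
      rw [Real.mul_rpow (by positivity) (by positivity), ← Real.rpow_mul hn0.le,
        Real.rpow_add hn0 _ (β i)]
      ring
    rw [e, hc', mul_assoc]
    have := Real.rpow_le_rpow_of_exponent_le hn1' (hexp i (Finset.mem_range.1 hi))
    gcongr
  calc (walkMeasure d).real {ω | (n : ℝ) ^ γ * y ≤ levelPowerSum ω n b a p}
      ≤ ∑ i ∈ Finset.range N, (walkMeasure d).real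
          {ω | K i ≤ ({x | (n : ℝ) ^ β i ≤ (localTime ω n x : ℝ)}.ncard : ℝ)} :=
        (measureReal_mono hsub (measure_ne_top _ _)).trans (measureReal_biUnion_finset_le _ _)
    _ ≤ ∑ _i ∈ Finset.range N, Real.exp (-(c' * (n : ℝ) ^ (ζ + δ))) :=
        Finset.sum_le_sum hterm
    _ = Real.exp (Real.log N - c' * (n : ℝ) ^ (ζ + δ)) := by
        rw [Finset.sum_const, Finset.card_range, nsmul_eq_mul, sub_eq_add_neg, Real.exp_add,
          Real.exp_log hN0']
    _ ≤ Real.exp (-(n : ℝ) ^ ζ) := by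
        apply Real.exp_le_exp.2
        rw [Real.rpow_add hn0]
        rw [div_le_iff₀ hc'0] at hnl
        have h1 : 1 ≤ (n : ℝ) ^ ζ := Real.one_le_rpow hn1' hζ.le
        have h2 : 0 ≤ Real.log N := Real.log_nonneg (by exact_mod_cast hN0)
        have h3 := mul_le_mul_of_nonneg_left hnl (by linarith : 0 ≤ (n : ℝ) ^ ζ)
        nlinarith

/-- The exponent is affine in the level, so that it is enough to control it at one end of the
range of levels, which depends on the position of `p` relative to `d / (d - 2)`. -/
theorem lt_exponent_of_or (hd : 3 ≤ d) {a b γ ζ p : ℝ} (hba : b < a)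
    (h : ((d : ℝ) / ((d : ℝ) - 2) ≤ p ∧ ζ < γ - a * (p - 1) - 2 / (d : ℝ) * (γ - a * p)) ∨
      (p ≤ (d : ℝ) / ((d : ℝ) - 2) ∧ ζ < γ - b * (p - 1) - 2 / (d : ℝ) * (γ - b * p))) :
    ζ < γ - a * (p - 1) - 2 / (d : ℝ) * (γ - a * p) ∧
      ζ < γ - b * (p - 1) - 2 / (d : ℝ) * (γ - b * p) := by
  have hd3 : (3 : ℝ) ≤ d := by exact_mod_cast hd
  -- The sign of p(d - 2) - d decides which endpoint carries the smaller exponent.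
  have hdiff : (γ - b * (p - 1) - 2 / (d : ℝ) * (γ - b * p)) -
      (γ - a * (p - 1) - 2 / (d : ℝ) * (γ - a * p)) =
        (a - b) * ((p * (d - 2) - d) / d) := by
    field_simp
    ring
  rcases h with ⟨hp, h⟩ | ⟨hp, h⟩
  · rw [div_le_iff₀ (by linarith)] at hp
    have : 0 ≤ (a - b) * ((p * (d - 2) - d) / d) :=
      mul_nonneg (by linarith) (div_nonneg (by linarith) (by linarith))
    exact ⟨h, by linarith⟩
  · rw [le_div_iff₀ (by linarith)] at hp
    have : (a - b) * ((p * (d - 2) - d) / d) ≤ 0 :=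
      mul_nonpos_of_nonneg_of_nonpos (by linarith)
        (div_nonpos_of_nonpos_of_nonneg (by linarith) (by linarith))
    exact ⟨by linarith, h⟩

end RWLocalTime

theorem proposition3p1 :
    -- low level sets, in dimension at least five
    (∀ (d : ℕ) (a b γ ζ p y : ℝ), 5 ≤ d →
      0 < a → 0 < b → 0 < γ → 0 < ζ → 0 < p → 0 < y → b < a →
      (2 < p → 1 + a * (p - 2) < γ) →
      (p ≤ 2 → 1 - b * (2 - p) < γ) →
      (((d : ℝ) / ((d : ℝ) - 2) ≤ p ∧
          ζ < γ - a * (p - 1) - 2 / (d : ℝ) * (γ - a * p)) ∨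
        (1 < p ∧ p ≤ (d : ℝ) / ((d : ℝ) - 2) ∧
          ζ < γ - b * (p - 1) - 2 / (d : ℝ) * (γ - b * p))) →
      ∃ c : ℝ, 0 < c ∧ ∀ᶠ n : ℕ in atTop,
        (RWLocalTime.walkMeasure d).real
            {ω | (n : ℝ) ^ γ * y ≤ RWLocalTime.levelPowerSum ω n b a p}
          ≤ Real.exp (-(c * (n : ℝ) ^ ζ))) ∧
    -- high level sets, in dimension at least three
    (∀ (d : ℕ) (a b γ ζ p y : ℝ), 3 ≤ d →
      0 < a → 0 < b → 0 < γ → 0 < ζ → 0 < p → 0 < y → b < a →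
      ζ ≤ (d : ℝ) / 2 * b →
      (((d : ℝ) / ((d : ℝ) - 2) ≤ p ∧
          ζ < γ / (p * (2 / (d : ℝ)) + 1) ∧
          ζ < γ - a * (p - 1) - 2 / (d : ℝ) * (γ - a * p)) ∨
        (1 < p ∧ p ≤ (d : ℝ) / ((d : ℝ) - 2) ∧
          ζ < γ - b * (p - 1) - 2 / (d : ℝ) * (γ - b * p))) →
      ∃ c : ℝ, 0 < c ∧ ∀ᶠ n : ℕ in atTop,
        (RWLocalTime.walkMeasure d).real
            {ω | (n : ℝ) ^ γ * y ≤ RWLocalTime.levelPowerSum ω n b a p}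
          ≤ Real.exp (-(c * (n : ℝ) ^ ζ))) := by
  constructor
  · intro d a b γ ζ p y hd _ hb _ hζ hp hy hba _ _ h
    obtain ⟨h1, h2⟩ := RWLocalTime.lt_exponent_of_or (by omega) hba
      (h.imp_right fun h => ⟨h.2.1, h.2.2⟩)
    refine ⟨1, one_pos, ?_⟩
    simpa only [one_mul] using RWLocalTime.eventually_measure_levelPowerSum_le (by omega)
      hb hζ hp hy hba h1 h2
  · intro d a b γ ζ p y hd _ hb _ hζ hp hy hba _ h
    obtain ⟨h1, h2⟩ := RWLocalTime.lt_exponent_of_or hd hba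
      (h.imp (fun h => ⟨h.1, h.2.2⟩) fun h => ⟨h.2.1, h.2.2⟩)
    refine ⟨1, one_pos, ?_⟩
    simpa only [one_mul] using RWLocalTime.eventually_measure_levelPowerSum_le hd
      hb hζ hp hy hba h1 h2
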